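/- A symmetric monoidal model category is a model category with a closed symmetric monoidal structure $(\otimes,\mathbb 1)$ satisfying the pushout-product axiom (the pushout-product of two cofibrations is a cofibration, acyclic if one of the two is) and the unit axiom (for a cofibrant replacement $c\mathbb 1\to\mathbb 1$ of the unit and cofibrant $X$, the map $c\mathbb 1\otimes X\to\mathbb 1\otimes X$ is a weak equivalence). Let $F:\mathcal C\rightleftarrows\mathcal D:U$ be a weak symmetric monoidal Quillen equivalence between symmetric monoidal model categories. That is, $(F,U)$ is a Quillen equivalence, $U$ is lax symmetric monoidal (so that $F$ is oplax symmetric monoidal), the oplax structure map $F(A\otimes B)\to FA\otimes FB$ is a weak equivalence for all cofibrant $A,B$, and for a cofibrant replacement $c\mathbb 1_{\mathcal C}\to\mathbb 1_{\mathcal C}$ the composite $F(c\mathbb 1_{\mathcal C})\to F(\mathbb 1_{\mathcal C})\to\mathbb 1_{\mathcal D}$ is a weak equivalence. It is called strong if all the oplax structure maps $F(A\otimes B)\to FA\otimes FB$ and $F(\mathbb 1_{\mathcal C})\to\mathbb 1_{\mathcal D}$ are isomorphisms. For $n\ge 0$, the symmetric group $\Sigma_n$ acts on $X^{\otimes n}$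 by permuting the factors, with $X^{\otimes 0}=\mathbb 1$, and the iterated oplax structure map $F(X^{\otimes n})\to (FX)^{\otimes n}$ is $\Sigma_n$-equivariant. Say that $(F,U)$ satisfies the orbit hypothesis at $n$ if for every cofibrant $X$ in $\mathcal C$ the induced map on orbits $$F(X^{\otimes n})/\Sigma_n\longrightarrow (FX)^{\otimes n}/\Sigma_n$$ is a weak equivalence in $\mathcal D$. It satisfies the orbit hypothesis if it does so at every $n\ge 0$. Let $\Sigma_n\mathcal D=[B\Sigma_n,\mathcal D]$ be the category of objects of $\mathcal D$ with a $\Sigma_n$-action. Such an object is underlying cofibrant if it is cofibrant in $\mathcal D$. It is naive cofibrant if the map to it from the initial object has the left lifting property with respect to all maps of $\Sigma_n\mathcal D$ that are acyclic fibrations in $\mathcal D$. Then: (i) If $(F,U)$ is a strong symmetric monoidal Quillen equivalence, then it satisfies the orbit hypothesis. (ii) If, for some $n$, every underlying cofibrant object of $\Sigma_n\mathcal D$ is naive cofibrant, and either $n\ge 1$ or the unit $\mathbb 1_{\mathcal C}$ is cofibrant, then $(F,U)$ satisfies the orbit hypothesis at $n$. In particular, if this condition on $\Sigma_n\mathcal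 D$ holds for all $n$ and $\mathbb 1_{\mathcal C}$ is cofibrant, then $(F,U)$ satisfies the orbit hypothesis. -/

import Mathlib

open CategoryTheory MonoidalCategory Limits HomotopicalAlgebra

noncomputable section

namespace OrbitLemma

/-! ### Adjacent transpositions and homomorphisms out of symmetric groups -/

/-- The transposition of `i` and `i + 1` in the symmetric group on `{0, …, m - 1}`
(and the identity if `i + 1` is out of range). -/
def adjSwap (m i : ℕ) : Equiv.Perm (Fin m) :=
  if h : i + 1 < m then Equiv.swap ⟨i, by omega⟩ ⟨i + 1, h⟩ else 1

/-- The Coxeter relations of the symmetric group on `m` letters, for a sequence `t 0, t 1, …` of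
elements of a monoid of which only those with `i + 1 < m` matter. -/
structure CoxeterRel (m : ℕ) {M : Type*} [Monoid M] (t : ℕ → M) : Prop where
  sq : ∀ i, i + 1 < m → t i * t i = 1
  comm : ∀ i j, i + 1 < j → j + 1 < m → t i * t j = t j * t i
  braid : ∀ i, i + 2 < m → t i * t (i + 1) * t i = t (i + 1) * t i * t (i + 1)

lemma adjSwap_apply (m i : ℕ) (h : i + 1 < m) (x : Fin m) :
    ((adjSwap m i x : Fin m) : ℕ) =
      if (x : ℕ) = i then i + 1 else if (x : ℕ) = i + 1 then i else x := by
  rw [adjSwap, dif_pos h, Equiv.swap_apply_def]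
  simp only [Fin.ext_iff]
  split_ifs <;> rfl

lemma coxeterRel_adjSwap (m : ℕ) : CoxeterRel m (adjSwap m) where
  sq i h := by
    rw [adjSwap, dif_pos h, Equiv.swap_mul_self]
  comm i j hij hj := by
    ext x
    simp only [Equiv.Perm.mul_apply, adjSwap_apply m i (by omega), adjSwap_apply m j hj]
    split_ifs <;> omega
  braid i h := by
    ext x
    simp only [Equiv.Perm.mul_apply, adjSwap_apply m i (by omega), adjSwap_apply m (i + 1) (by omega)]
    split_ifs <;> omega

section Words

variable {M : Type*} [Monoid M]

/-- The value of a word in the elements `t i`. -/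
def ev (t : ℕ → M) (w : List ℕ) : M := (w.map t).prod

@[simp] lemma ev_nil (t : ℕ → M) : ev t [] = 1 := rfl

@[simp] lemma ev_cons (t : ℕ → M) (i : ℕ) (w : List ℕ) : ev t (i :: w) = t i * ev t w := by
  simp [ev]

lemma ev_append (t : ℕ → M) (v w : List ℕ) : ev t (v ++ w) = ev t v * ev t w := by
  simp [ev]

/-- The word `k + d - 1, …, k + 1, k`. -/
def desc (k : ℕ) : ℕ → List ℕ
  | 0 => []
  | d + 1 => (k + d) :: desc k d

lemma CoxeterRel.comm_desc {m : ℕ} {t : ℕ → M} (h : CoxeterRel m t) (k j : ℕ) (hj : j + 1 < m) :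
    ∀ d, k + d < j →
      t j * ev t (desc k d) = ev t (desc k d) * t j
  | 0, _ => by simp [desc]
  | d + 1, h1 => by
    have ih := CoxeterRel.comm_desc h k j hj d (by omega)
    have hc := h.comm (k + d) j (by omega) hj
    simp only [desc, ev_cons]
    rw [← mul_assoc, ← hc, mul_assoc, ih, mul_assoc]

lemma CoxeterRel.shift_desc {m : ℕ} {t : ℕ → M} (h : CoxeterRel m t) (k j : ℕ) (hk : k ≤ j) :
    ∀ d, j + 2 ≤ k + d → k + d < m →
      t j * ev t (desc k d) = ev t (desc k d) * t (j + 1)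
  | 0, h1, _ => by omega
  | 1, h1, _ => by omega
  | d + 2, h1, h2 => by
    by_cases hj : j = k + d
    · subst hj
      have hc := CoxeterRel.comm_desc h k (k + d + 1) (by omega) d (by omega)
      have hb := h.braid (k + d) (by omega)
      simp only [desc, ev_cons]
      rw [← add_assoc, ← mul_assoc, ← mul_assoc, hb, mul_assoc, mul_assoc, hc]
      simp only [mul_assoc]
    · have ih := CoxeterRel.shift_desc h k j hk (d + 1) (by omega) (by omega)
      have hc := h.comm j (k + (d + 1)) (by omega) (by omega)
      rw [desc, ev_cons, ← mul_assoc, hc, mul_assoc, ih, mul_assoc]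

lemma CoxeterRel.normal_form {m : ℕ} {t : ℕ → M} (h : CoxeterRel m t) (k : ℕ) (hk : k < m) :
    ∀ w : List ℕ, (∀ i ∈ w, k ≤ i ∧ i + 1 < m) →
      ∃ d, k + d < m ∧ ∃ w' : List ℕ, (∀ i ∈ w', k + 1 ≤ i ∧ i + 1 < m) ∧
        ev t w = ev t (desc k d) * ev t w'
  | [], _ => ⟨0, by omega, [], by simp, by simp [desc]⟩
  | j :: w, hw => by
    obtain ⟨d, hd, w', hw', he⟩ :=
      CoxeterRel.normal_form h k hk w (fun i hi => hw i (List.mem_cons_of_mem _ hi))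
    obtain ⟨hj1, hj2⟩ := hw j List.mem_cons_self
    rw [ev_cons, he]
    rcases Nat.lt_trichotomy j (k + d) with hlt | heq | hgt
    · by_cases hlast : j + 1 = k + d
      · obtain ⟨d', rfl⟩ : ∃ d', d = d' + 1 := ⟨d - 1, by omega⟩
        obtain rfl : j = k + d' := by omega
        refine ⟨d', by omega, w', hw', ?_⟩
        rw [desc, ev_cons, ← mul_assoc, ← mul_assoc, h.sq _ hj2, one_mul]
      · refine ⟨d, hd, (j + 1) :: w', ?_, ?_⟩
        · intro i hi
          rcases List.mem_cons.1 hi with rfl | hi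
          · omega
          · exact hw' i hi
        · rw [← mul_assoc, h.shift_desc k j hj1 d (by omega) hd, ev_cons, mul_assoc]
    · subst heq
      exact ⟨d + 1, by omega, w', hw', by rw [desc, ev_cons, mul_assoc]⟩
    · refine ⟨d, hd, j :: w', ?_, ?_⟩
      · intro i hi
        rcases List.mem_cons.1 hi with rfl | hi
        · omega
        · exact hw' i hi
      · rw [← mul_assoc, h.comm_desc k j hj2 d (by omega),
          ev_cons, mul_assoc]

lemma ev_adjSwap_fix (m k : ℕ) (x : Fin m) (hx : (x : ℕ) = k) :
    ∀ w : List ℕ, (∀ i ∈ w, k + 1 ≤ i ∧ i + 1 < m) → ev (adjSwap m) w x = x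
  | [], _ => rfl
  | j :: w, hw => by
    rw [ev_cons, Equiv.Perm.mul_apply,
      ev_adjSwap_fix m k x hx w (fun i hi => hw i (List.mem_cons_of_mem _ hi))]
    obtain ⟨h1, h2⟩ := hw j List.mem_cons_self
    ext
    rw [adjSwap_apply m j h2]
    split_ifs <;> omega

lemma ev_adjSwap_desc (m k : ℕ) (x : Fin m) (hx : (x : ℕ) = k) :
    ∀ d, k + d < m → ((ev (adjSwap m) (desc k d) x : Fin m) : ℕ) = k + d
  | 0, _ => by simp [desc, hx]
  | d + 1, h => by
    rw [desc, ev_cons, Equiv.Perm.mul_apply, adjSwap_apply m (k + d) (by omega),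
      ev_adjSwap_desc m k x hx d (by omega), if_pos rfl]
    omega

lemma ev_prod {M' : Type*} [Monoid M'] (s : ℕ → M') (t : ℕ → M) (w : List ℕ) :
    ev (fun i => (s i, t i)) w = (ev s w, ev t w) := by
  induction w with
  | nil => rfl
  | cons i w ih => simp [ih]

lemma CoxeterRel.prod {M' : Type*} [Monoid M'] {m : ℕ} {s : ℕ → M'} {t : ℕ → M}
    (hs : CoxeterRel m s) (ht : CoxeterRel m t) : CoxeterRel m (fun i => (s i, t i)) where
  sq i h := Prod.ext (hs.sq i h) (ht.sq i h)
  comm i j h h' := Prod.ext (hs.comm i j h h') (ht.comm i j h h')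
  braid i h := Prod.ext (hs.braid i h) (ht.braid i h)

lemma CoxeterRel.ev_eq_one_aux {m : ℕ} {t : ℕ → M} (h : CoxeterRel m t) :
    ∀ r k : ℕ, k + r = m → ∀ w : List ℕ, (∀ i ∈ w, k ≤ i ∧ i + 1 < m) →
      ev (adjSwap m) w = 1 → ev t w = 1
  | 0, k, hk, w, hw, _ => by
    cases w with
    | nil => rfl
    | cons i w =>
      have := hw i List.mem_cons_self
      omega
  | r + 1, k, hk, w, hw, h1 => by
    obtain ⟨d, hd, w', hw', he⟩ :=
      CoxeterRel.normal_form ((coxeterRel_adjSwap m).prod h) k (by omega) w hw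
    simp only [ev_prod, Prod.mk_mul_mk, Prod.mk.injEq] at he
    obtain ⟨he1, he2⟩ := he
    have hd0 : d = 0 := by
      have h2 := ev_adjSwap_desc m k ⟨k, by omega⟩ rfl d hd
      have h3 := ev_adjSwap_fix m k ⟨k, by omega⟩ rfl w' hw'
      have h4 := congrArg (fun σ : Equiv.Perm (Fin m) => ((σ ⟨k, by omega⟩ : Fin m) : ℕ)) he1
      simp only [h1, Equiv.Perm.mul_apply, h3, h2, Equiv.Perm.one_apply] at h4
      omega
    subst hd0
    simp only [desc, ev_nil, one_mul] at he1 he2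
    rw [he2]
    exact CoxeterRel.ev_eq_one_aux h r (k + 1) (by omega) w' hw' (by rw [← he1, h1])

lemma CoxeterRel.ev_reverse {m : ℕ} {t : ℕ → M} (h : CoxeterRel m t) :
    ∀ w : List ℕ, (∀ i ∈ w, i + 1 < m) → ev t w.reverse * ev t w = 1
  | [], _ => by simp
  | j :: w, hw => by
    have ih := CoxeterRel.ev_reverse h w (fun i hi => hw i (List.mem_cons_of_mem _ hi))
    have hj := h.sq j (hw j List.mem_cons_self)
    rw [List.reverse_cons, ev_append, ev_cons, ev_cons, ev_nil, mul_one, mul_assoc,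
      ← mul_assoc (t j), hj, one_mul, ih]

/-- Two words in the adjacent transpositions with the same value in the symmetric group have
the same value in every monoid in which the Coxeter relations hold. -/
lemma CoxeterRel.ev_eq {m : ℕ} {t : ℕ → M} (h : CoxeterRel m t) (v w : List ℕ)
    (hv : ∀ i ∈ v, i + 1 < m) (hw : ∀ i ∈ w, i + 1 < m)
    (e : ev (adjSwap m) v = ev (adjSwap m) w) : ev t v = ev t w := by
  have h1 : ev (adjSwap m) (v ++ w.reverse) = 1 := by
    rw [ev_append, e]
    exact mul_eq_one_comm.1 ((coxeterRel_adjSwap m).ev_reverse w hw)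
  have h2 : ev t (v ++ w.reverse) = 1 := by
    refine h.ev_eq_one_aux m 0 (by omega) _ ?_ h1
    intro i hi
    rcases List.mem_append.1 hi with hi | hi
    · exact ⟨by omega, hv i hi⟩
    · exact ⟨by omega, hw i (List.mem_reverse.1 hi)⟩
  rw [ev_append] at h2
  calc ev t v = ev t v * (ev t w.reverse * ev t w) := by rw [h.ev_reverse w hw, mul_one]
    _ = ev t w := by rw [← mul_assoc, h2, one_mul]

lemma exists_word (m : ℕ) (σ : Equiv.Perm (Fin m)) :
    ∃ w : List ℕ, (∀ i ∈ w, i + 1 < m) ∧ ev (adjSwap m) w = σ := by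
  cases m with
  | zero => exact ⟨[], by simp, Subsingleton.elim _ _⟩
  | succ n =>
    have hσ : σ ∈ Submonoid.closure
        (Set.range fun i : Fin n ↦ Equiv.swap i.castSucc i.succ) := by
      rw [Equiv.Perm.mclosure_swap_castSucc_succ]; trivial
    induction hσ using Submonoid.closure_induction with
    | mem x hx =>
      obtain ⟨i, rfl⟩ := hx
      refine ⟨[i], by simp, ?_⟩
      simp only [ev_cons, ev_nil, mul_one]
      rw [adjSwap, dif_pos (by simp)]
      rfl
    | one => exact ⟨[], by simp, rfl⟩
    | mul x y _ _ hx hy =>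
      obtain ⟨v, hv, rfl⟩ := hx
      obtain ⟨w, hw, rfl⟩ := hy
      refine ⟨v ++ w, ?_, ev_append _ _ _⟩
      intro i hi
      rcases List.mem_append.1 hi with hi | hi
      exacts [hv i hi, hw i hi]

/-- The homomorphism from the symmetric group on `{0, …, m - 1}` to a monoid that sends the
transposition of `i` and `i + 1` to `t i`, where the `t i` satisfy the Coxeter relations.
It is unique, since these transpositions generate. -/
def permLift (m : ℕ) (t : ℕ → M) (h : CoxeterRel m t) : Equiv.Perm (Fin m) →* M where
  toFun σ := ev t (exists_word m σ).choose
  map_one' := h.ev_eq _ [] (exists_word m 1).choose_spec.1 (by simp)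
    (exists_word m 1).choose_spec.2
  map_mul' σ τ := by
    rw [← ev_append]
    refine h.ev_eq _ _ (exists_word m (σ * τ)).choose_spec.1 ?_ ?_
    · intro i hi
      rcases List.mem_append.1 hi with hi | hi
      exacts [(exists_word m σ).choose_spec.1 i hi, (exists_word m τ).choose_spec.1 i hi]
    · rw [ev_append, (exists_word m σ).choose_spec.2, (exists_word m τ).choose_spec.2,
        (exists_word m (σ * τ)).choose_spec.2]

lemma permLift_ev (m : ℕ) (t : ℕ → M) (h : CoxeterRel m t) (w : List ℕ)
    (hw : ∀ i ∈ w, i + 1 < m) : permLift m t h (ev (adjSwap m) w) = ev t w :=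
  h.ev_eq _ _ (exists_word m _).choose_spec.1 hw (exists_word m _).choose_spec.2

lemma permLift_adjSwap (m : ℕ) (t : ℕ → M) (h : CoxeterRel m t) (i : ℕ) (hi : i + 1 < m) :
    permLift m t h (adjSwap m i) = t i := by
  simpa using permLift_ev m t h [i] (by simpa using hi)

end Words

/-! ### Tensor powers with the action of the symmetric group, and their orbits -/

section TensorPower

universe v u

variable {C : Type u} [Category.{v} C] [MonoidalCategory C]

/-- The tensor power `X ⊗ (X ⊗ (⋯ ⊗ (X ⊗ 𝟙)))` with `n` factors `X`. -/
def tensorPow (X : C) : ℕ → C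
  | 0 => 𝟙_ C
  | n + 1 => X ⊗ tensorPow X n

lemma whiskerLeft_sq (X : C) {Y : C} {f : Y ⟶ Y} (h : f ≫ f = 𝟙 _) :
    (X ◁ f) ≫ X ◁ f = 𝟙 _ := by
  rw [← MonoidalCategory.whiskerLeft_comp, h, MonoidalCategory.whiskerLeft_id]

lemma whiskerLeft_comm (X : C) {Y : C} {f g : Y ⟶ Y} (h : f ≫ g = g ≫ f) :
    (X ◁ f) ≫ X ◁ g = (X ◁ g) ≫ X ◁ f := by
  rw [← MonoidalCategory.whiskerLeft_comp, h, MonoidalCategory.whiskerLeft_comp]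

lemma whiskerLeft_braid (X : C) {Y : C} {f g : Y ⟶ Y} (h : f ≫ g ≫ f = g ≫ f ≫ g) :
    (X ◁ f) ≫ (X ◁ g) ≫ X ◁ f = (X ◁ g) ≫ (X ◁ f) ≫ X ◁ g := by
  simp only [← MonoidalCategory.whiskerLeft_comp, h]

variable [SymmetricCategory C]

/-- The map of `X ⊗ (X ⊗ Y)` that interchanges the first two factors by the symmetry. -/
def swapFront (X Y : C) : X ⊗ X ⊗ Y ⟶ X ⊗ X ⊗ Y :=
  (α_ X X Y).inv ≫ (β_ X X).hom ▷ Y ≫ (α_ X X Y).hom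

lemma swapFront_sq (X Y : C) : swapFront X Y ≫ swapFront X Y = 𝟙 _ := by
  simp only [swapFront, Category.assoc, Iso.hom_inv_id_assoc]
  rw [← comp_whiskerRight_assoc, SymmetricCategory.symmetry]
  simp

lemma swapFront_naturality (X : C) {Y Y' : C} (f : Y ⟶ Y') :
    swapFront X Y ≫ X ◁ X ◁ f = (X ◁ X ◁ f) ≫ swapFront X Y' := by
  simp only [swapFront, Category.assoc]
  rw [← associator_naturality_right, ← whisker_exchange_assoc,
    associator_inv_naturality_right_assoc]

lemma swapFront_braid (X Y : C) :
    swapFront X (X ⊗ Y) ≫ X ◁ swapFront X Y ≫ swapFront X (X ⊗ Y) =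
      X ◁ swapFront X Y ≫ swapFront X (X ⊗ Y) ≫ X ◁ swapFront X Y := by
  have yb := congrArg (fun f => (α_ X X (X ⊗ Y)).inv ≫
    (α_ (X ⊗ X) X Y).inv ≫ ((α_ X X X).hom ≫ f) ▷ Y ≫ (α_ X (X ⊗ X) Y).hom ≫
    X ◁ (α_ X X Y).hom) (BraidedCategory.yang_baxter X X X)
  simp only [swapFront]
  convert yb using 1
  · monoidal
  · monoidal

/-- The map `𝟙 ⊗ ⋯ ⊗ β ⊗ ⋯ ⊗ 𝟙` of the tensor power that interchanges the factors in
positions `i` and `i + 1` (counted from `0`) by the symmetry `β`. -/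
def interchange (X : C) : ∀ (n : ℕ) (_ : ℕ), tensorPow X n ⟶ tensorPow X n
  | 0, _ => 𝟙 _
  | 1, _ => 𝟙 _
  | n + 2, 0 => swapFront X (tensorPow X n)
  | n + 2, i + 1 => X ◁ interchange X (n + 1) i

lemma interchange_sq (X : C) : ∀ n i, interchange X n i ≫ interchange X n i = 𝟙 _
  | 0, _ => Category.comp_id _
  | 1, _ => Category.comp_id _
  | n + 2, 0 => swapFront_sq X (tensorPow X n)
  | n + 2, i + 1 => whiskerLeft_sq X (interchange_sq X (n + 1) i)

lemma interchange_comm (X : C) : ∀ n i j, i + 1 < j → j + 1 < n →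
    interchange X n i ≫ interchange X n j = interchange X n j ≫ interchange X n i
  | 0, _, _, _, h => by omega
  | 1, _, _, _, h => by omega
  | n + 2, _, 0, h, _ => by omega
  | n + 2, 0, 1, h, _ => by omega
  | 2, 0, j + 2, _, h => by omega
  | n + 3, 0, j + 2, _, _ => swapFront_naturality X (interchange X (n + 1) j)
  | n + 2, i + 1, j + 1, h, h' =>
    whiskerLeft_comm X (interchange_comm X (n + 1) i j (by omega) (by omega))

lemma interchange_braid (X : C) : ∀ n i, i + 2 < n →
    interchange X n i ≫ interchange X n (i + 1) ≫ interchange X n i =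
      interchange X n (i + 1) ≫ interchange X n i ≫ interchange X n (i + 1)
  | 0, _, h => by omega
  | 1, _, h => by omega
  | 2, _, h => by omega
  | n + 3, 0, _ => swapFront_braid X (tensorPow X n)
  | n + 3, i + 1, h => whiskerLeft_braid X (interchange_braid X (n + 2) i (by omega))

lemma coxeterRel_interchange (X : C) (n : ℕ) :
    CoxeterRel n (M := End (tensorPow X n)) (interchange X n) where
  sq i _ := interchange_sq X n i
  comm i j h h' := (interchange_comm X n i j h h').symm
  braid i h := interchange_braid X n i h

/-- The tensor power `X^{⊗ n}` as an object with an action of the symmetric group `Σ_n`: the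
transposition of `i` and `i + 1` acts by interchanging the corresponding factors. -/
def symPow (X : C) (n : ℕ) : SingleObj (Equiv.Perm (Fin n)) ⥤ C :=
  SingleObj.functor (permLift n (M := End (tensorPow X n)) (interchange X n)
    (coxeterRel_interchange X n))

lemma symPow_map_adjSwap (X : C) (n i : ℕ) (hi : i + 1 < n) :
    (symPow X n).map (X := SingleObj.star _) (Y := SingleObj.star _) (adjSwap n i) =
      interchange X n i :=
  permLift_adjSwap n (M := End (tensorPow X n)) _ (coxeterRel_interchange X n) i hi

end TensorPower

/-! ### The comparison map on orbits of tensor powers -/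

section Comparison

universe v₁ v₂ u₁ u₂

variable {C : Type u₁} [Category.{v₁} C] [MonoidalCategory C]
  {D : Type u₂} [Category.{v₂} D] [MonoidalCategory D]

/-- The iterated oplax structure map `F (X^{⊗ n}) ⟶ (F X)^{⊗ n}`. -/
def powComparison (F : C ⥤ D) [F.OplaxMonoidal] (X : C) :
    ∀ n, F.obj (tensorPow X n) ⟶ tensorPow (F.obj X) n
  | 0 => Functor.OplaxMonoidal.η F
  | n + 1 => Functor.OplaxMonoidal.δ F X (tensorPow X n) ≫ F.obj X ◁ powComparison F X n

variable [SymmetricCategory C] [SymmetricCategory D] {F : C ⥤ D} {U : D ⥤ C}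

/-- The oplax structure on the left adjoint of a lax symmetric monoidal functor is symmetric. -/
lemma delta_braiding (adj : F ⊣ U) [F.OplaxMonoidal] [U.LaxBraided] [adj.IsMonoidal] (X Y : C) :
    F.map (β_ X Y).hom ≫ Functor.OplaxMonoidal.δ F Y X =
      Functor.OplaxMonoidal.δ F X Y ≫ (β_ (F.obj X) (F.obj Y)).hom := by
  apply (adj.homEquiv _ _).injective
  simp only [Adjunction.homEquiv_unit, Functor.map_comp, Adjunction.unit_naturality_assoc]
  rw [Adjunction.unit_app_tensor_comp_map_δ, Adjunction.unit_app_tensor_comp_map_δ_assoc,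
    Functor.LaxBraided.braided, BraidedCategory.braiding_naturality_assoc]

lemma map_swapFront (adj : F ⊣ U) [F.OplaxMonoidal] [U.LaxBraided] [adj.IsMonoidal] (X Y : C) :
    F.map (swapFront X Y) ≫ Functor.OplaxMonoidal.δ F X (X ⊗ Y) ≫
        F.obj X ◁ Functor.OplaxMonoidal.δ F X Y =
      (Functor.OplaxMonoidal.δ F X (X ⊗ Y) ≫ F.obj X ◁ Functor.OplaxMonoidal.δ F X Y) ≫
        swapFront (F.obj X) (F.obj Y) := by
  have h := Functor.OplaxMonoidal.associativity F X X Y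
  simp only [swapFront, Functor.map_comp, Category.assoc]
  rw [← h, ← Functor.OplaxMonoidal.δ_natural_left_assoc, ← comp_whiskerRight_assoc,
    delta_braiding adj, comp_whiskerRight_assoc, Functor.OplaxMonoidal.associativity_inv_assoc]

lemma map_interchange (adj : F ⊣ U) [F.OplaxMonoidal] [U.LaxBraided] [adj.IsMonoidal] (X : C) :
    ∀ n i, F.map (interchange X n i) ≫ powComparison F X n =
      powComparison F X n ≫ interchange (F.obj X) n i
  | 0, _ => by simp [interchange]
  | 1, _ => by simp [interchange]
  | n + 2, 0 => by
    have h1 := map_swapFront adj X (tensorPow X n)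
    have h2 := swapFront_naturality (F.obj X) (powComparison F X n)
    change F.map (swapFront X (tensorPow X n)) ≫ Functor.OplaxMonoidal.δ F X (X ⊗ tensorPow X n) ≫
      F.obj X ◁ (Functor.OplaxMonoidal.δ F X (tensorPow X n) ≫ F.obj X ◁ powComparison F X n) =
      (Functor.OplaxMonoidal.δ F X (X ⊗ tensorPow X n) ≫
      F.obj X ◁ (Functor.OplaxMonoidal.δ F X (tensorPow X n) ≫ F.obj X ◁ powComparison F X n)) ≫
        swapFront (F.obj X) (tensorPow (F.obj X) n)
    simp only [MonoidalCategory.whiskerLeft_comp, Category.assoc] at h1 ⊢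
    rw [← h2, reassoc_of% h1]
  | n + 2, i + 1 => by
    have ih := map_interchange adj X (n + 1) i
    change F.map (X ◁ interchange X (n + 1) i) ≫
      Functor.OplaxMonoidal.δ F X (tensorPow X (n + 1)) ≫ F.obj X ◁ powComparison F X (n + 1) =
      (Functor.OplaxMonoidal.δ F X (tensorPow X (n + 1)) ≫
        F.obj X ◁ powComparison F X (n + 1)) ≫ F.obj X ◁ interchange (F.obj X) (n + 1) i
    rw [Category.assoc, ← MonoidalCategory.whiskerLeft_comp, ← ih,
      ← Functor.OplaxMonoidal.δ_natural_right_assoc, MonoidalCategory.whiskerLeft_comp]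

lemma map_permLift (adj : F ⊣ U) [F.OplaxMonoidal] [U.LaxBraided] [adj.IsMonoidal] (X : C)
    (n : ℕ) (σ : Equiv.Perm (Fin n)) :
    F.map (permLift n (M := End (tensorPow X n)) _ (coxeterRel_interchange X n) σ) ≫
        powComparison F X n =
      powComparison F X n ≫
        permLift n (M := End (tensorPow (F.obj X) n)) _ (coxeterRel_interchange (F.obj X) n) σ := by
  obtain ⟨w, hw, rfl⟩ := exists_word n σ
  rw [permLift_ev _ _ _ w hw, permLift_ev _ _ _ w hw]
  clear hw
  induction w with
  | nil =>
    change F.map (𝟙 _) ≫ _ = _ ≫ 𝟙 _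
    simp
  | cons i w ih =>
    rw [ev_cons, ev_cons, End.mul_def, End.mul_def, Functor.map_comp, Category.assoc,
      map_interchange adj, reassoc_of% ih]

/-- The iterated oplax structure map `F (X^{⊗ n}) ⟶ (F X)^{⊗ n}` as a map of objects with an
action of the symmetric group. -/
def symPowComparison (adj : F ⊣ U) [F.OplaxMonoidal] [U.LaxBraided] [adj.IsMonoidal] (X : C)
    (n : ℕ) : symPow X n ⋙ F ⟶ symPow (F.obj X) n :=
  SingleObj.natTrans (powComparison F X n) (map_permLift adj X n)

/-- The natural map `F (X^{⊗ n}) / Σ_n ⟶ (F X)^{⊗ n} / Σ_n`, where orbits are the colimit over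
the one-object category of the symmetric group. -/
def orbitComparison [HasFiniteColimits D] (adj : F ⊣ U) [F.OplaxMonoidal] [U.LaxBraided]
    [adj.IsMonoidal] (X : C) (n : ℕ) :
    colimit (symPow X n ⋙ F) ⟶ colimit (symPow (F.obj X) n) :=
  colimMap (symPowComparison adj X n)

end Comparison

/-! ### Symmetric monoidal model categories and weak symmetric monoidal Quillen equivalences -/

section Model

universe v₁ v₂ u₁ u₂

/-- The compatibility of a model structure with a closed symmetric monoidal structure:
the pushout-product axiom and the unit axiom. -/
class IsSymmetricMonoidalModelCategory (C : Type u₁) [Category.{v₁} C] [MonoidalCategory C]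
    [SymmetricCategory C] [MonoidalClosed C] [ModelCategory C] : Prop where
  pushoutProduct_cofibration {A B X Y : C} (f : A ⟶ B) (g : X ⟶ Y) :
    Cofibration f → Cofibration g →
      Cofibration ((Arrow.pushoutProduct.obj (.mk f)).obj (.mk g)).hom
  pushoutProduct_acyclic {A B X Y : C} (f : A ⟶ B) (g : X ⟶ Y) :
    Cofibration f → Cofibration g → (WeakEquivalence f ∨ WeakEquivalence g) →
      WeakEquivalence ((Arrow.pushoutProduct.obj (.mk f)).obj (.mk g)).hom
  unit_axiom {c : C} (q : c ⟶ 𝟙_ C) : IsCofibrant c → WeakEquivalence q →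
    ∀ X : C, IsCofibrant X → WeakEquivalence (q ▷ X)

variable {C : Type u₁} [Category.{v₁} C] [ModelCategory C]
  {D : Type u₂} [Category.{v₂} D] [ModelCategory D]

/-- A Quillen adjunction: the left adjoint preserves cofibrations and acyclic cofibrations. -/
structure IsQuillenAdjunction {F : C ⥤ D} {U : D ⥤ C} (_adj : F ⊣ U) : Prop where
  cofibration {A B : C} (f : A ⟶ B) : Cofibration f → Cofibration (F.map f)
  acyclic {A B : C} (f : A ⟶ B) : Cofibration f → WeakEquivalence f → WeakEquivalence (F.map f)

/-- A Quillen equivalence: for `A` cofibrant and `B` fibrant, a map `F A ⟶ B` is a weak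
equivalence if and only if its adjunct `A ⟶ U B` is. -/
structure IsQuillenEquivalence {F : C ⥤ D} {U : D ⥤ C} (adj : F ⊣ U) : Prop
    extends IsQuillenAdjunction adj where
  weakEquivalence_iff (A : C) (B : D) (f : F.obj A ⟶ B) : IsCofibrant A → IsFibrant B →
    (WeakEquivalence f ↔ WeakEquivalence (adj.homEquiv A B f))

variable [MonoidalCategory C] [SymmetricCategory C] [MonoidalCategory D] [SymmetricCategory D]

/-- A weak symmetric monoidal Quillen equivalence: a Quillen equivalence whose right adjoint is
lax symmetric monoidal and whose left adjoint, with the corresponding oplax structure, satisfies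
the two conditions below. -/
structure IsWeakSymmetricMonoidalQuillenEquivalence {F : C ⥤ D} {U : D ⥤ C} (adj : F ⊣ U)
    [F.OplaxMonoidal] [U.LaxBraided] [adj.IsMonoidal] : Prop
    extends IsQuillenEquivalence adj where
  weakEquivalence_δ (A B : C) : IsCofibrant A → IsCofibrant B →
    WeakEquivalence (Functor.OplaxMonoidal.δ F A B)
  weakEquivalence_η {c : C} (q : c ⟶ 𝟙_ C) : IsCofibrant c → WeakEquivalence q →
    WeakEquivalence (F.map q ≫ Functor.OplaxMonoidal.η F)

/-- A strong symmetric monoidal Quillen equivalence: one for which moreover all oplax structure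
maps are isomorphisms. -/
structure IsStrongSymmetricMonoidalQuillenEquivalence {F : C ⥤ D} {U : D ⥤ C} (adj : F ⊣ U)
    [F.OplaxMonoidal] [U.LaxBraided] [adj.IsMonoidal] : Prop
    extends IsWeakSymmetricMonoidalQuillenEquivalence adj where
  isIso_δ (A B : C) : IsIso (Functor.OplaxMonoidal.δ F A B)
  isIso_η : IsIso (Functor.OplaxMonoidal.η F)

/-- The orbit hypothesis for the symmetric group `Σ_n`: for all cofibrant `X`, the natural map
`F (X^{⊗ n}) / Σ_n ⟶ (F X)^{⊗ n} / Σ_n` is a weak equivalence. -/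
def OrbitHypothesisAt {F : C ⥤ D} {U : D ⥤ C} (adj : F ⊣ U)
    [F.OplaxMonoidal] [U.LaxBraided] [adj.IsMonoidal] (n : ℕ) : Prop :=
  ∀ X : C, IsCofibrant X → WeakEquivalence (orbitComparison adj X n)

/-- The orbit hypothesis: for all `n` and all cofibrant `X`, the natural map
`F (X^{⊗ n}) / Σ_n ⟶ (F X)^{⊗ n} / Σ_n` is a weak equivalence. -/
def OrbitHypothesis {F : C ⥤ D} {U : D ⥤ C} (adj : F ⊣ U)
    [F.OplaxMonoidal] [U.LaxBraided] [adj.IsMonoidal] : Prop :=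
  ∀ n : ℕ, OrbitHypothesisAt adj n

end Model

/-! ### Naive cofibrant objects with a group action -/

section Naive

universe w v u

variable (D : Type u) [Category.{v} D] [ModelCategory D] (G : Type w) [Group G]

/-- The functor that forgets the action of the group. -/
abbrev underlying : (SingleObj G ⥤ D) ⥤ D :=
  (evaluation (SingleObj G) D).obj (SingleObj.star G)

/-- Naive acyclic fibrations: equivariant maps whose underlying map is a fibration and a weak
equivalence. -/
def naiveAcyclicFibrations : MorphismProperty (SingleObj G ⥤ D) :=
  ((fibrations D).inverseImage (underlying D G)) ⊓
    ((weakEquivalences D).inverseImage (underlying D G))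

/-- Naive cofibrations: equivariant maps with the left lifting property with respect to the naive
acyclic fibrations. -/
def naiveCofibrations : MorphismProperty (SingleObj G ⥤ D) :=
  (naiveAcyclicFibrations D G).llp

variable {D G}

/-- The underlying object is cofibrant. -/
def IsUnderlyingCofibrant (A : SingleObj G ⥤ D) : Prop :=
  IsCofibrant ((underlying D G).obj A)

/-- The map from the initial object is a naive cofibration. -/
def IsNaiveCofibrant (A : SingleObj G ⥤ D) : Prop :=
  naiveCofibrations D G (initial.to A)

end Naive

end OrbitLemma

end

/-!
The strong case is formal: the iterated oplax structure maps are isomorphisms, hence so are the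
maps that they induce on orbits.

In the weak case the iterated structure map `F (X^{⊗ n}) ⟶ (F X)^{⊗ n}` is, for `n ≥ 1`, a weak
equivalence between cofibrant objects (`weakEquivalence_powComparison`); for `n = 1` this is the
unitality of the oplax structure, so that the units need not be cofibrant. For `n = 0` the group
is trivial and the map is the oplax unit. It remains to see that orbits preserve underlying weak
equivalences between underlying cofibrant objects, if all underlying cofibrant objects are naive
cofibrant (`weakEquivalence_colimMap`). As `D` is an arbitrary model category, maps of `Σ_n D` need
not have equivariant factorizations, and the naive model structure is not available. The closed
symmetric monoidal structure replaces it.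

* Let `c ⟶ 𝟙_ D` be a cofibrant replacement of the unit. With the trivial action, `c` is naive
  cofibrant, so it lifts against the equivariant pullback-hom of an underlying acyclic
  cofibration and a fibration of `D`. By adjunction the functor `(- ⊗ c) / Σ_n` sends underlying
  acyclic cofibrations to acyclic cofibrations
  (`hasLiftingProperty_whiskerRight_triv`, `mem_trivialCofibrations_colimMap`).
* Tensoring with a cylinder of `c` gives an equivariant mapping cylinder of `f ⊗ c`, for every
  equivariant map `f` between underlying cofibrant objects (`mappingCylinder_cofibration`). So
  Ken Brown's argument applies to `(- ⊗ c) / Σ_n` and shows that `f ⊗ c ⊗ c` induces a weak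
  equivalence on orbits if `f` is an underlying weak equivalence
  (`weakEquivalence_colimMap_whiskerRight`).
* The orbits of a naive cofibrant object are cofibrant and commute with `- ⊗ c`, so the two
  factors `c` can be removed by the unit axiom (`weakEquivalence_colimMap_rightUnitor`).
-/

namespace OrbitLemma

universe w v u v' u' v₁ v₂ u₁ u₂

/-! ### Weak equivalences between cofibrant objects and tensor products -/

section BrownLemma

variable {M : Type u} [Category.{v} M] [ModelCategory M] {N : Type u'} [Category.{v'} N]
  [ModelCategory N]

/-- Ken Brown's lemma: a functor that sends acyclic cofibrations between cofibrant objects to weak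
equivalences sends all weak equivalences between cofibrant objects to weak equivalences. -/
lemma weakEquivalence_map_of_isCofibrant (K : M ⥤ N)
    (hK : ∀ {A B : M} (i : A ⟶ B), IsCofibrant A → Cofibration i → WeakEquivalence i →
      WeakEquivalence (K.map i))
    {A B : M} [IsCofibrant A] [IsCofibrant B] (f : A ⟶ B) [WeakEquivalence f] :
    WeakEquivalence (K.map f) := by
  obtain ⟨h⟩ : Nonempty (CofibrantBrownFactorization f) := inferInstance
  have hi : WeakEquivalence (K.map h.i) := hK _ inferInstance inferInstance inferInstance
  have hs : WeakEquivalence (K.map h.s) := hK _ inferInstance inferInstance inferInstance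
  have hp : WeakEquivalence (K.map h.p) :=
    weakEquivalence_of_precomp_of_fac (f := K.map h.s) (fg := 𝟙 _)
      (by rw [← K.map_comp, h.s_p, K.map_id])
  rw [← h.fac, K.map_comp]
  infer_instance

lemma isCofibrant_obj_of_adjunction {K : M ⥤ N} {R : N ⥤ M} (adj : K ⊣ R)
    (hK : ∀ {A B : M} (i : A ⟶ B), Cofibration i → Cofibration (K.map i))
    (A : M) [hA : IsCofibrant A] : IsCofibrant (K.obj A) := by
  have := adj.leftAdjoint_preservesColimits
  exact (isCofibrant_iff_of_isInitial (K.map (initial.to A))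
    (IsInitial.isInitialObj K _ initialIsInitial)).2 (hK _ hA)

end BrownLemma

section Unit

variable {M : Type u} [Category.{v} M] [MonoidalCategory M] [ModelCategory M]

variable (M) in
lemma exists_cofibrant_replacement_unit :
    ∃ (c : M) (q : c ⟶ 𝟙_ M), IsCofibrant c ∧ WeakEquivalence q := by
  let h := MorphismProperty.factorizationData (cofibrations M) (trivialFibrations M)
    (initial.to (𝟙_ M))
  exact ⟨h.Z, h.p, (isCofibrant_iff_of_isInitial h.i initialIsInitial).2 inferInstance,
    inferInstance⟩

lemma weakEquivalence_whiskerRight_iff [BraidedCategory M] {X Y : M} (g : X ⟶ Y) (A : M) :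
    WeakEquivalence (g ▷ A) ↔ WeakEquivalence (A ◁ g) := by
  simp only [weakEquivalence_iff]
  exact (weakEquivalences M).arrow_mk_iso_iff
    (Arrow.isoMk (β_ X A) (β_ Y A) (BraidedCategory.braiding_naturality_left g A).symm)

end Unit

lemma whiskerLeft_rightUnitor_naturality {M : Type u} [Category.{v} M] [MonoidalCategory M]
    {c : M} (q : c ⟶ 𝟙_ M) {A B : M} (f : A ⟶ B) :
    (A ◁ q ≫ (ρ_ A).hom) ≫ f = f ▷ c ≫ B ◁ q ≫ (ρ_ B).hom := by
  rw [← whisker_exchange_assoc, rightUnitor_naturality, Category.assoc]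

section Tensor

variable {M : Type u} [Category.{v} M] [MonoidalCategory M] [SymmetricCategory M]
  [MonoidalClosed M] [ModelCategory M] [IsSymmetricMonoidalModelCategory M]

/-- The pushout-product axiom, for an arbitrary choice of the pushout. -/
lemma cofibration_pushoutObjObj {A B X Y : M} {f : A ⟶ B} {g : X ⟶ Y} [hf : Cofibration f]
    [hg : Cofibration g] (sq : (curriedTensor M).PushoutObjObj f g) : Cofibration sq.ι := by
  have h := IsSymmetricMonoidalModelCategory.pushoutProduct_cofibration f g hf hg
  rw [cofibration_iff] at h ⊢
  exact ((cofibrations M).arrow_mk_iso_iff (Functor.PushoutObjObj.ι_iso_of_iso_left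
    (f₁ := .mk f) (f₁' := .mk f) (f₂ := .mk g) sq (.ofHasPushout ..) (Iso.refl _))).2 h

lemma weakEquivalence_pushoutObjObj {A B X Y : M} {f : A ⟶ B} {g : X ⟶ Y} [hf : Cofibration f]
    [hg : Cofibration g] (h : WeakEquivalence f ∨ WeakEquivalence g)
    (sq : (curriedTensor M).PushoutObjObj f g) : WeakEquivalence sq.ι := by
  have h := IsSymmetricMonoidalModelCategory.pushoutProduct_acyclic f g hf hg h
  rw [weakEquivalence_iff] at h ⊢
  exact ((weakEquivalences M).arrow_mk_iso_iff (Functor.PushoutObjObj.ι_iso_of_iso_left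
    (f₁ := .mk f) (f₁' := .mk f) (f₂ := .mk g) sq (.ofHasPushout ..) (Iso.refl _))).2 h

/-- The pullback-hom of a cofibration and a fibration, one of which is a weak equivalence, is
an acyclic fibration. -/
lemma mem_trivialFibrations_pullbackObjObj {A B X Y : M} {f : A ⟶ B} {p : X ⟶ Y}
    [Cofibration f] [Fibration p] (h : WeakEquivalence f ∨ WeakEquivalence p)
    (sq : (MonoidalClosed.internalHom (C := M)).PullbackObjObj f p) :
    trivialFibrations M sq.π := by
  rw [← cofibrations_rlp]
  intro K L g hg
  have hg' : Cofibration g := (cofibration_iff _).2 hg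
  rw [← MonoidalClosed.internalHomAdjunction₂.hasLiftingProperty_iff (.ofHasPushout _ f g)]
  have := cofibration_pushoutObjObj (.ofHasPushout (curriedTensor M) f g)
  rcases h with h | h
  · have := weakEquivalence_pushoutObjObj (.inl h) (.ofHasPushout (curriedTensor M) f g)
    infer_instance
  · infer_instance

instance cofibration_whiskerLeft (A : M) [IsCofibrant A] {X Y : M} (g : X ⟶ Y)
    [Cofibration g] : Cofibration (A ◁ g) :=
  cofibration_pushoutObjObj
    (.ofIsInitialLeft (curriedTensor M) (initial.to A) g initialIsInitial)

lemma weakEquivalence_whiskerLeft_of_cofibration (A : M) [IsCofibrant A] {X Y : M} (g : X ⟶ Y)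
    [Cofibration g] [hg : WeakEquivalence g] : WeakEquivalence (A ◁ g) :=
  weakEquivalence_pushoutObjObj (.inr hg)
    (.ofIsInitialLeft (curriedTensor M) (initial.to A) g initialIsInitial)

instance isCofibrant_tensorObj (A B : M) [IsCofibrant A] [IsCofibrant B] :
    IsCofibrant (A ⊗ B) :=
  (isCofibrant_iff_of_isInitial (A ◁ initial.to B)
    (IsInitial.isInitialObj (tensorLeft A) _ initialIsInitial)).2 inferInstance

instance weakEquivalence_whiskerLeft (A : M) [IsCofibrant A] {X Y : M} (g : X ⟶ Y)
    [IsCofibrant X] [IsCofibrant Y] [WeakEquivalence g] : WeakEquivalence (A ◁ g) :=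
  weakEquivalence_map_of_isCofibrant (tensorLeft A)
    (fun i _ _ _ => weakEquivalence_whiskerLeft_of_cofibration A i) g

instance weakEquivalence_whiskerRight {X Y : M} (g : X ⟶ Y) (A : M) [IsCofibrant A]
    [IsCofibrant X] [IsCofibrant Y] [WeakEquivalence g] : WeakEquivalence (g ▷ A) :=
  (weakEquivalence_whiskerRight_iff g A).2 inferInstance

lemma isCofibrant_tensorPow (X : M) [IsCofibrant X] : ∀ n, 1 ≤ n → IsCofibrant (tensorPow X n)
  | 1, _ => (isCofibrant_iff_of_isInitial (initial.to X ≫ (ρ_ X).inv) initialIsInitial).2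
      inferInstance
  | n + 2, _ => by
    have := isCofibrant_tensorPow X (n + 1) (by omega)
    exact isCofibrant_tensorObj X (tensorPow X (n + 1))

/-- For a weak equivalence `c ⟶ 𝟙_ M` with `c` and `A` cofibrant, the map
`A ⊗ c ⟶ A ⊗ 𝟙_ M ⟶ A` is a weak equivalence. -/
lemma weakEquivalence_whiskerLeft_rightUnitor {c : M} [hc : IsCofibrant c] (q : c ⟶ 𝟙_ M)
    [hq : WeakEquivalence q] (A : M) [hA : IsCofibrant A] :
    WeakEquivalence (A ◁ q ≫ (ρ_ A).hom) := by
  have := (weakEquivalence_whiskerRight_iff q A).1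
    (IsSymmetricMonoidalModelCategory.unit_axiom q hc hq A hA)
  infer_instance

/-- The mapping cylinder of `f ▷ c : A ⊗ c ⟶ B ⊗ c` formed with the cylinder `A ⊗ P` of `A ⊗ c`:
the inclusion of the end `B ⊗ c` is an acyclic cofibration, that of `A ⊗ c` a cofibration. -/
lemma mappingCylinder_cofibration {A B c : M} [IsCofibrant A] [IsCofibrant B] [IsCofibrant c]
    (P : Cylinder c) [P.IsGood] (f : A ⟶ B) {Z : M} {inl : A ⊗ P.I ⟶ Z} {inr : B ⊗ c ⟶ Z}
    (sq : IsPushout (A ◁ P.i₀) (f ▷ c) inl inr) :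
    trivialCofibrations M inr ∧ Cofibration (A ◁ P.i₁ ≫ inl) := by
  refine ⟨MorphismProperty.of_isPushout sq.flip ?_, ?_⟩
  · exact mem_trivialCofibrations _
  · -- `N` is the disjoint union of the two ends: the pushout of `A ⊗ (c ⨿ c)` along `f ▷ c` on
    -- the first summand; its inclusion `ψ` into the cylinder is a cobase change of `A ◁ P.i`
    let N := pushout (A ◁ (coprod.inl : c ⟶ c ⨿ c)) (f ▷ c)
    have top : IsPushout (A ◁ (coprod.inl : c ⟶ c ⨿ c)) (f ▷ c) (pushout.inl _ _ : _ ⟶ N)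
      (pushout.inr _ _) := IsPushout.of_hasPushout _ _
    have fac : A ◁ (coprod.inl : c ⟶ c ⨿ c) ≫ A ◁ P.i = A ◁ P.i₀ := by
      rw [← MonoidalCategory.whiskerLeft_comp, Precylinder.inl_i]
    let ψ : N ⟶ Z := top.desc (A ◁ P.i ≫ inl) inr (by rw [reassoc_of% fac, sq.w])
    have hψ : Cofibration ψ := by
      have : IsPushout (A ◁ P.i) (pushout.inl _ _ : _ ⟶ N) inl ψ := by
        refine (IsPushout.of_left (h₁₁ := A ◁ (coprod.inl : c ⟶ c ⨿ c)) (v₁₁ := f ▷ c)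
          (h₂₁ := pushout.inr _ _) ?_ (by simp [ψ]) top)
        rw [fac]
        simpa [ψ] using sq
      rw [cofibration_iff]
      exact MorphismProperty.of_isPushout this.flip (mem_cofibrations _)
    have hN : Cofibration (A ◁ (coprod.inr : c ⟶ c ⨿ c) ≫ (pushout.inl _ _ : _ ⟶ N)) := by
      have s1 := (IsPushout.of_isColimit_binaryCofan_of_isInitial
        (colimit.isColimit (pair c c)) initialIsInitial).map (tensorLeft A)
      have s2 := s1.flip.paste_horiz top.flip
      have : Cofibration ((tensorLeft A).map (initialIsInitial.to c) ≫ f ▷ c) := by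
        rw [← isCofibrant_iff_of_isInitial _
          (IsInitial.isInitialObj (tensorLeft A) _ initialIsInitial)]
        exact isCofibrant_tensorObj B c
      rw [cofibration_iff]
      exact MorphismProperty.of_isPushout s2.flip this.mem
    have : A ◁ P.i₁ ≫ inl =
        (A ◁ (coprod.inr : c ⟶ c ⨿ c) ≫ (pushout.inl _ _ : _ ⟶ N)) ≫ ψ := by
      simp [ψ, ← MonoidalCategory.whiskerLeft_comp_assoc]
    rw [this]
    infer_instance

end Tensor

/-! ### Orbits of objects with a group action -/

section InternalHom

variable {D : Type u} [Category.{v} D] [MonoidalCategory D] [MonoidalClosed D]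
  {J : Type*} [Groupoid J]

/-- Internal homs of functors on a groupoid are computed objectwise. -/
lemma ihom_map_app (A : J ⥤ D) {X Y : J ⥤ D} (p : X ⟶ Y) (x : J) :
    ((ihom A).map p).app x = (ihom (A.obj x)).map (p.app x) := by
  rw [Functor.ihom_map]
  simp only [Functor.closedIhom_map_app]
  rfl

lemma pre_app_app {A B : J ⥤ D} (j : A ⟶ B) (X : J ⥤ D) (x : J) :
    ((MonoidalClosed.pre j).app X).app x = (MonoidalClosed.pre (j.app x)).app (X.obj x) := by
  apply MonoidalClosed.uncurry_injective (A := A.obj x) (X := X.obj x)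
  exact (MonoidalClosed.uncurry_eq _).trans
    ((congr_app (MonoidalClosed.id_tensor_pre_app_comp_ev j X) x).trans
      (MonoidalClosed.uncurry_pre (j.app x) (X.obj x)).symm)

end InternalHom

section Equivariant

variable {D : Type u} [Category.{v} D] [ModelCategory D] {G : Type w} [Group G]

/-- Orbits of a naive cofibrant object are cofibrant, since the trivial action functor is right
adjoint to orbits and sends acyclic fibrations to naive acyclic fibrations. -/
lemma isCofibrant_colimit [HasColimitsOfShape (SingleObj G) D] {A : SingleObj G ⥤ D}
    (hA : IsNaiveCofibrant A) : IsCofibrant (colimit A) := by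
  have : PreservesColimitsOfSize.{0, 0} (colim : (SingleObj G ⥤ D) ⥤ D) :=
    colimConstAdj.leftAdjoint_preservesColimits
  refine (isCofibrant_iff_of_isInitial (colim.map (initial.to A))
    (IsInitial.isInitialObj colim _ initialIsInitial)).2 ?_
  rw [cofibration_iff, ← trivialFibrations_llp]
  intro X Y p hp
  rw [colimConstAdj.hasLiftingProperty_iff]
  exact hA _ hp

lemma weakEquivalence_colimMap_of_subsingleton [HasColimitsOfShape (SingleObj G) D]
    [Subsingleton G] {A B : SingleObj G ⥤ D} (f : A ⟶ B)
    [WeakEquivalence (f.app (SingleObj.star G))] : WeakEquivalence (colimMap f) := by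
  have (x : SingleObj G) : Unique (x ⟶ SingleObj.star G) :=
    { default := (1 : G), uniq := fun _ => Subsingleton.elim (α := G) _ _ }
  have := isIso_ι_of_isTerminal (IsTerminal.ofUnique (SingleObj.star G)) A
  have := isIso_ι_of_isTerminal (IsTerminal.ofUnique (SingleObj.star G)) B
  exact weakEquivalence_of_precomp_of_fac (ι_colimMap f (SingleObj.star G))

variable [MonoidalCategory D] [SymmetricCategory D] [MonoidalClosed D]
  [IsSymmetricMonoidalModelCategory D]

variable (G) in
/-- An object of `D` with the trivial action of `G`. -/
abbrev triv (X : D) : SingleObj G ⥤ D := (Functor.const _).obj X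

/-- For an underlying cofibration `j` and a fibration `p` of `D`, one of which is a weak
equivalence, the pullback-hom of `j` and `p`, with `G` acting by conjugation, is a naive acyclic
fibration. An object `c` with trivial action that is naive cofibrant lifts against it, so `j ⊗ c`
lifts against `p`. -/
lemma hasLiftingProperty_whiskerRight_triv {c : D} (hc : IsNaiveCofibrant (triv G c))
    {A B : SingleObj G ⥤ D} (j : A ⟶ B) [Cofibration (j.app (SingleObj.star G))]
    {X Y : D} (p : X ⟶ Y) [Fibration p]
    (h : WeakEquivalence (j.app (SingleObj.star G)) ∨ WeakEquivalence p) :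
    HasLiftingProperty (j ▷ triv G c) ((Functor.const _).map p) := by
  let sq : (curriedTensor (SingleObj G ⥤ D)).PushoutObjObj j (initial.to (triv G c)) :=
    .ofIsInitialRight _ j _ initialIsInitial
  let sq' : (MonoidalClosed.internalHom (C := SingleObj G ⥤ D)).PullbackObjObj j
    ((Functor.const (SingleObj G)).map p) := .ofHasPullback _ _ _
  suffices HasLiftingProperty sq.ι ((Functor.const _).map p) from this
  rw [MonoidalClosed.internalHomAdjunction₂.hasLiftingProperty_iff sq sq']
  apply hc
  -- the underlying map of the equivariant pullback-hom is the pullback-hom in `D`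
  let sq'' : (MonoidalClosed.internalHom (C := D)).PullbackObjObj (j.app (SingleObj.star G)) p :=
    { pt := sq'.pt.obj (SingleObj.star G)
      fst := sq'.fst.app (SingleObj.star G)
      snd := sq'.snd.app (SingleObj.star G)
      isPullback := by
        have h := sq'.isPullback.map (underlying D G)
        have e₁ := ihom_map_app A ((Functor.const (SingleObj G)).map p) (SingleObj.star G)
        have e₂ := pre_app_app j ((Functor.const (SingleObj G)).obj Y) (SingleObj.star G)
        exact e₁ ▸ e₂ ▸ h
      π := sq'.π.app (SingleObj.star G)
      π_fst := (congr_app sq'.π_fst (SingleObj.star G)).trans (pre_app_app j _ _)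
      π_snd := (congr_app sq'.π_snd (SingleObj.star G)).trans (ihom_map_app B _ _) }
  exact mem_trivialFibrations_pullbackObjObj h sq''

lemma mem_trivialCofibrations_colimMap [HasColimitsOfShape (SingleObj G) D] {c : D}
    (hc : IsNaiveCofibrant (triv G c)) {A B : SingleObj G ⥤ D} (j : A ⟶ B)
    [Cofibration (j.app (SingleObj.star G))] [WeakEquivalence (j.app (SingleObj.star G))] :
    trivialCofibrations D (colim.map (j ▷ triv G c)) := by
  rw [← fibrations_llp]
  intro X Y p hp
  have : Fibration p := (fibration_iff _).2 hp
  rw [colimConstAdj.hasLiftingProperty_iff]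
  exact hasLiftingProperty_whiskerRight_triv hc j p (.inl inferInstance)

/-- If the underlying map of `f` is a weak equivalence between cofibrant objects, then
`f ⊗ c ⊗ c` induces a weak equivalence on orbits: by `mem_trivialCofibrations_colimMap` the
functor `(- ⊗ c) / G` can be applied to the equivariant mapping cylinder of `f ⊗ c`. -/
lemma weakEquivalence_colimMap_whiskerRight [HasColimitsOfShape (SingleObj G) D] {c : D}
    [IsCofibrant c] (hc : IsNaiveCofibrant (triv G c)) {A B : SingleObj G ⥤ D} (f : A ⟶ B)
    [IsCofibrant (A.obj (SingleObj.star G))] [IsCofibrant (B.obj (SingleObj.star G))]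
    [WeakEquivalence (f.app (SingleObj.star G))] :
    WeakEquivalence (colim.map ((f ▷ triv G c) ▷ triv G c)) := by
  obtain ⟨P, _⟩ := Cylinder.exists_very_good c
  let T : D ⥤ SingleObj G ⥤ D := Functor.const _
  -- `Z` is the mapping cylinder, with ends `k` and `s` and retraction `r` onto the end `s`
  have sq := IsPushout.of_hasPushout (A ◁ T.map P.i₀) (f ▷ triv G c)
  let Z := pushout (A ◁ T.map P.i₀) (f ▷ triv G c)
  let s : B ⊗ triv G c ⟶ Z := pushout.inr _ _
  let k : A ⊗ triv G c ⟶ Z := A ◁ T.map P.i₁ ≫ pushout.inl _ _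
  let r : Z ⟶ B ⊗ triv G c := sq.desc (A ◁ T.map P.π ≫ f ▷ triv G c) (𝟙 _) (by
    rw [← MonoidalCategory.whiskerLeft_comp_assoc, ← T.map_comp, P.i₀_π]
    simp [T])
  have hs : s ≫ r = 𝟙 _ := sq.inr_desc _ _ _
  have hk : k ≫ r = f ▷ triv G c := by
    simp only [k, r, Category.assoc]
    rw [sq.inl_desc, ← MonoidalCategory.whiskerLeft_comp_assoc, ← T.map_comp, P.i₁_π]
    simp [T]
  obtain ⟨h₁, h₂ : Cofibration (k.app (SingleObj.star G))⟩ :=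
    mappingCylinder_cofibration P (f.app (SingleObj.star G)) (sq.map (underlying D G))
  obtain ⟨h₃, h₄⟩ : Cofibration (s.app (SingleObj.star G)) ∧
    WeakEquivalence (s.app (SingleObj.star G)) := (mem_trivialCofibrations_iff _).1 h₁
  have h₅ : WeakEquivalence (r.app (SingleObj.star G)) :=
    weakEquivalence_of_precomp_of_fac (f := s.app (SingleObj.star G)) (fg := 𝟙 _)
      (congr_app hs _)
  have h₆ : WeakEquivalence ((f ▷ triv G c).app (SingleObj.star G)) :=
    weakEquivalence_whiskerRight (f.app (SingleObj.star G)) c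
  have h₇ : WeakEquivalence (k.app (SingleObj.star G)) :=
    weakEquivalence_of_postcomp_of_fac (congr_app hk (SingleObj.star G))
  have h₈ := ((mem_trivialCofibrations_iff _).1 (mem_trivialCofibrations_colimMap hc s)).2
  have h₉ := ((mem_trivialCofibrations_iff _).1 (mem_trivialCofibrations_colimMap hc k)).2
  have h₁₀ : WeakEquivalence (colim.map (r ▷ triv G c)) :=
    weakEquivalence_of_precomp_of_fac (f := colim.map (s ▷ triv G c)) (fg := 𝟙 _)
      (by rw [← Functor.map_comp, ← comp_whiskerRight, hs, MonoidalCategory.id_whiskerRight,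
        CategoryTheory.Functor.map_id])
  rw [← hk, comp_whiskerRight, Functor.map_comp]
  infer_instance

/-- The map `(A ⊗ c) / G ⟶ A / G` induced by a cofibrant replacement `c ⟶ 𝟙_ D` is identified
with `A / G ⊗ c ⟶ A / G`, where `A / G` is cofibrant, so that the unit axiom applies. -/
lemma weakEquivalence_colimMap_rightUnitor [HasColimitsOfShape (SingleObj G) D] {c : D}
    [IsCofibrant c] (q : c ⟶ 𝟙_ D) [WeakEquivalence q] {A : SingleObj G ⥤ D}
    (hA : IsNaiveCofibrant A) :
    WeakEquivalence (colim.map (A ◁ (Functor.const (SingleObj G)).map q ≫ (ρ_ A).hom)) := by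
  have := isCofibrant_colimit hA
  -- `- ⊗ c` preserves colimits, since `D` is closed
  let i : A ⋙ tensorRight c ≅ A ⊗ triv G c :=
    NatIso.ofComponents (fun x => Iso.refl (A.obj x ⊗ c))
      (by simp [MonoidalCategory.tensorHom_def])
  let e : colimit A ⊗ c ≅ colimit (A ⊗ triv G c) :=
    preservesColimitIso (tensorRight c) A ≪≫ colim.mapIso i
  have he (x : SingleObj G) : colimit.ι A x ▷ c ≫ e.hom = colimit.ι (A ⊗ triv G c) x :=
    (Category.assoc _ _ _).symm.trans ((congrArg (· ≫ colimMap i.hom)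
      (ι_preservesColimitIso_hom (tensorRight c) A x)).trans
        ((ι_colimMap i.hom x).trans (Category.id_comp _)))
  have fac : e.hom ≫ colim.map (A ◁ (Functor.const (SingleObj G)).map q ≫ (ρ_ A).hom) =
      colimit A ◁ q ≫ (ρ_ _).hom := by
    refine (isColimitOfPreserves (tensorRight c) (colimit.isColimit A)).hom_ext fun x => ?_
    change colimit.ι A x ▷ c ≫ e.hom ≫ _ = colimit.ι A x ▷ c ≫ _
    rw [reassoc_of% he]
    refine (ι_colimMap _ x).trans ?_
    exact whiskerLeft_rightUnitor_naturality q (colimit.ι A x)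
  have := weakEquivalence_whiskerLeft_rightUnitor q (colimit A)
  exact weakEquivalence_of_precomp_of_fac fac

/-- If all underlying cofibrant objects are naive cofibrant, then orbits preserve underlying weak
equivalences between underlying cofibrant objects. -/
theorem weakEquivalence_colimMap [HasColimitsOfShape (SingleObj G) D]
    (hG : ∀ A : SingleObj G ⥤ D, IsUnderlyingCofibrant A → IsNaiveCofibrant A)
    {A B : SingleObj G ⥤ D} (f : A ⟶ B) (hA : IsUnderlyingCofibrant A)
    (hB : IsUnderlyingCofibrant B) [WeakEquivalence (f.app (SingleObj.star G))] :
    WeakEquivalence (colimMap f) := by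
  obtain ⟨c, q, hc, hq⟩ := exists_cofibrant_replacement_unit D
  have hA' : IsCofibrant (A.obj (SingleObj.star G)) := hA
  have hB' : IsCofibrant (B.obj (SingleObj.star G)) := hB
  have hf := weakEquivalence_colimMap_whiskerRight (hG (triv G c) hc) f
  let Q : triv G c ⟶ 𝟙_ (SingleObj G ⥤ D) := (Functor.const (SingleObj G)).map q
  let t (E : SingleObj G ⥤ D) : (E ⊗ triv G c) ⊗ triv G c ⟶ E :=
    ((E ⊗ triv G c) ◁ Q ≫ (ρ_ (E ⊗ triv G c)).hom) ≫ E ◁ Q ≫ (ρ_ E).hom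
  have ht (E : SingleObj G ⥤ D) (hE : IsUnderlyingCofibrant E) :
      WeakEquivalence (colim.map (t E)) := by
    have : IsCofibrant (E.obj (SingleObj.star G)) := hE
    have h₁ := weakEquivalence_colimMap_rightUnitor q (hG E hE)
    have h₂ := weakEquivalence_colimMap_rightUnitor q
      (hG (E ⊗ triv G c) (isCofibrant_tensorObj (E.obj (SingleObj.star G)) c))
    rw [Functor.map_comp]
    infer_instance
  have fac : colim.map (t A) ≫ colim.map f =
      colim.map ((f ▷ triv G c) ▷ triv G c) ≫ colim.map (t B) := by
    rw [← Functor.map_comp, ← Functor.map_comp]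
    congr 1
    have h₁ := whiskerLeft_rightUnitor_naturality Q f
    have h₂ := whiskerLeft_rightUnitor_naturality Q (f ▷ triv G c)
    simp only [Category.assoc] at h₁ h₂
    simp only [t, Category.assoc]
    rw [h₁, reassoc_of% h₂]
  have := ht A hA
  have := ht B hB
  exact weakEquivalence_of_precomp_of_fac fac

end Equivariant

/-! ### The comparison map of tensor powers -/

section Comparison

variable {C : Type u₁} [Category.{v₁} C] [MonoidalCategory C]
  {D : Type u₂} [Category.{v₂} D] [MonoidalCategory D]

lemma isIso_powComparison (F : C ⥤ D) [F.OplaxMonoidal] [IsIso (Functor.OplaxMonoidal.η F)]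
    [∀ A B, IsIso (Functor.OplaxMonoidal.δ F A B)] (X : C) : ∀ n, IsIso (powComparison F X n)
  | 0 => inferInstanceAs (IsIso (Functor.OplaxMonoidal.η F))
  | n + 1 => by
    have := isIso_powComparison F X n
    exact inferInstanceAs (IsIso
      (Functor.OplaxMonoidal.δ F X (tensorPow X n) ≫ F.obj X ◁ powComparison F X n))

/-- On the first tensor power `X ⊗ 𝟙_ C` the comparison map is the composite of two unit
isomorphisms, by the unitality of the oplax structure, even if the oplax unit is not invertible. -/
lemma isIso_powComparison_one (F : C ⥤ D) [F.OplaxMonoidal] (X : C) :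
    IsIso (powComparison F X 1) := by
  have : powComparison F X 1 = F.map (ρ_ X).hom ≫ (ρ_ (F.obj X)).inv := by
    rw [← Functor.OplaxMonoidal.right_unitality_hom]
    simp [powComparison, tensorPow]
  rw [this]
  exact inferInstanceAs (IsIso (F.map (ρ_ X).hom ≫ (ρ_ (F.obj X)).inv))

variable [SymmetricCategory C] [ModelCategory C] [SymmetricCategory D] [ModelCategory D]
  {F : C ⥤ D} {U : D ⥤ C}

theorem IsStrongSymmetricMonoidalQuillenEquivalence.orbitHypothesis (adj : F ⊣ U)
    [F.OplaxMonoidal] [U.LaxBraided] [adj.IsMonoidal]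
    (hs : IsStrongSymmetricMonoidalQuillenEquivalence adj) : OrbitHypothesis adj := by
  intro n X _
  have := hs.isIso_δ
  have := hs.isIso_η
  have := isIso_powComparison F X n
  have : ∀ x, IsIso ((symPowComparison adj X n).app x) := fun _ => this
  have : IsIso (symPowComparison adj X n) := NatIso.isIso_of_isIso_app _
  have : IsIso (orbitComparison adj X n) :=
    inferInstanceAs (IsIso (colim.map (symPowComparison adj X n)))
  infer_instance

variable [MonoidalClosed C] [IsSymmetricMonoidalModelCategory C] [MonoidalClosed D]
  [IsSymmetricMonoidalModelCategory D]

lemma weakEquivalence_powComparison (adj : F ⊣ U) [F.OplaxMonoidal] [U.LaxBraided]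
    [adj.IsMonoidal] (h : IsWeakSymmetricMonoidalQuillenEquivalence adj) (X : C)
    [hX : IsCofibrant X] : ∀ n, 1 ≤ n → WeakEquivalence (powComparison F X n)
  | 1, _ => by
    have := isIso_powComparison_one F X
    infer_instance
  | n + 2, _ => by
    have := weakEquivalence_powComparison adj h X (n + 1) (by omega)
    have hF (A : C) [IsCofibrant A] := isCofibrant_obj_of_adjunction adj h.cofibration A
    have h₁ := isCofibrant_tensorPow X (n + 1) (by omega)
    have h₂ := isCofibrant_tensorPow (F.obj X) (n + 1) (by omega)
    have := h.weakEquivalence_δ X (tensorPow X (n + 1)) hX h₁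
    have := weakEquivalence_whiskerLeft (F.obj X) (powComparison F X (n + 1))
    exact inferInstanceAs (WeakEquivalence (Functor.OplaxMonoidal.δ F X (tensorPow X (n + 1)) ≫
      F.obj X ◁ powComparison F X (n + 1)))

theorem IsWeakSymmetricMonoidalQuillenEquivalence.orbitHypothesisAt (adj : F ⊣ U)
    [F.OplaxMonoidal] [U.LaxBraided] [adj.IsMonoidal]
    (h : IsWeakSymmetricMonoidalQuillenEquivalence adj) (n : ℕ)
    (hn : ∀ A : SingleObj (Equiv.Perm (Fin n)) ⥤ D,
      IsUnderlyingCofibrant A → IsNaiveCofibrant A)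
    (hn' : 1 ≤ n ∨ IsCofibrant (𝟙_ C)) : OrbitHypothesisAt adj n := by
  intro X hX
  rcases Nat.eq_zero_or_pos n with rfl | hpos
  · have h₁ : IsCofibrant (𝟙_ C) := hn'.resolve_left (by omega)
    have h₀ := h.weakEquivalence_η (𝟙 (𝟙_ C)) h₁ inferInstance
    rw [F.map_id, Category.id_comp] at h₀
    have : WeakEquivalence ((symPowComparison adj X 0).app (SingleObj.star _)) := h₀
    exact weakEquivalence_colimMap_of_subsingleton (symPowComparison adj X 0)
  · have h₁ := isCofibrant_tensorPow X n hpos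
    have h₂ := isCofibrant_obj_of_adjunction adj h.cofibration (tensorPow X n)
    have h₃ := isCofibrant_obj_of_adjunction adj h.cofibration X
    have h₄ := isCofibrant_tensorPow (F.obj X) n hpos
    have : WeakEquivalence ((symPowComparison adj X n).app (SingleObj.star _)) :=
      weakEquivalence_powComparison adj h X n hpos
    exact weakEquivalence_colimMap hn (symPowComparison adj X n) h₂ h₄

end Comparison

end OrbitLemma

theorem mainTheorem7
    {C : Type*} [Category* C] [MonoidalCategory C] [SymmetricCategory C] [MonoidalClosed C]
    [ModelCategory C] [OrbitLemma.IsSymmetricMonoidalModelCategory C]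
    {D : Type*} [Category* D] [MonoidalCategory D] [SymmetricCategory D] [MonoidalClosed D]
    [ModelCategory D] [OrbitLemma.IsSymmetricMonoidalModelCategory D]
    {F : C ⥤ D} {U : D ⥤ C} (adj : F ⊣ U)
    [F.OplaxMonoidal] [U.LaxBraided] [adj.IsMonoidal]
    (h : OrbitLemma.IsWeakSymmetricMonoidalQuillenEquivalence adj) :
    (OrbitLemma.IsStrongSymmetricMonoidalQuillenEquivalence adj →
      OrbitLemma.OrbitHypothesis adj) ∧
    (∀ n : ℕ,
      (∀ A : SingleObj (Equiv.Perm (Fin n)) ⥤ D,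
        OrbitLemma.IsUnderlyingCofibrant A → OrbitLemma.IsNaiveCofibrant A) →
      (1 ≤ n ∨ IsCofibrant (𝟙_ C)) →
      OrbitLemma.OrbitHypothesisAt adj n) :=
  ⟨OrbitLemma.IsStrongSymmetricMonoidalQuillenEquivalence.orbitHypothesis adj,
    OrbitLemma.IsWeakSymmetricMonoidalQuillenEquivalence.orbitHypothesisAt adj h⟩
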